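/- Let $f:\mathbb{F}_2^4\to\mathbb{F}_2^4$ be a permutation (bijection), and write $\langle x,y\rangle=\sum_i x_iy_i\in\mathbb{F}_2$ and $\hat f_u(x)=f(x+u)+f(x)$. Suppose that 1. $\mathrm{Lin}(f)=8$, where $$\mathrm{Lin}(f)=\max_{a\in\mathbb{F}_2^4,\ b\in\mathbb{F}_2^4\setminus\{0\}}\Bigl|\sum_{x\in\mathbb{F}_2^4}(-1)^{\langle f(x),b\rangle+\langle a,x\rangle}\Bigr|$$ is the maximum absolute Walsh coefficient; 2. $f$ is $4$-differentially uniform, i.e. $|\{x\in\mathbb{F}_2^4:\hat f_u(x)=v\}|\le 4$ for all $u\in\mathbb{F}_2^4\setminus\{0\}$ and all $v\in\mathbb{F}_2^4$; 3. $n_3(f)\ge 14$, where $n_3(f)$ is the number of $v\in\mathbb{F}_2^4\setminus\{0\}$ for which the Boolean function $x\mapsto\langle f(x),v\rangle$ has algebraic degree $3$ (the degree of its algebraic normal form). Then $f$ is weakly APN (weakly $2$-differentially uniform), i.e. $|\{\hat f_u(x):x\in\mathbb{F}_2^4\}|>2^{4-1}/2=4$ for every $u\in\mathbb{F}_2^4\setminus\{0\}$.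 -/

import Mathlib

namespace SBox

/-- The space of `m`-bit vectors. -/
abbrev Vec (m : ℕ) : Type := Fin m → ZMod 2

variable {m : ℕ}

/-- The derivative of `f` in direction `u`. -/
def deriv (f : Vec m → Vec m) (u : Vec m) : Vec m → Vec m :=
  fun x => f (x + u) + f x

/-- The component function `⟨f, v⟩` (standard inner product). -/
def component (f : Vec m → Vec m) (v : Vec m) : Vec m → ZMod 2 :=
  fun x => ∑ i, f x i * v i

/-- Every nonzero-direction derivative takes each value at most `δ` times. -/
def DifferentiallyUniform (δ : ℕ) (f : Vec m → Vec m) : Prop :=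
  ∀ u : Vec m, u ≠ 0 → ∀ v : Vec m,
    (Finset.univ.filter (fun x : Vec m => deriv f u x = v)).card ≤ δ

/-- Every nonzero-direction derivative has an image of more than `2 ^ (m - 1) / δ` elements;
the exponent is an integer and the quotient is an exact rational number. -/
def WeaklyDifferentiallyUniform (δ : ℕ) (f : Vec m → Vec m) : Prop :=
  ∀ u : Vec m, u ≠ 0 →
    (2 : ℚ) ^ ((m : ℤ) - 1) / (δ : ℚ) < ((Finset.univ.image (deriv f u)).card : ℚ)

/-- Weakly almost perfectly nonlinear functions. -/
def WeaklyAPN (f : Vec m → Vec m) : Prop :=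
  WeaklyDifferentiallyUniform 2 f

/-- The Walsh coefficient `∑ x, (-1) ^ (g x + ⟨a, x⟩)` of a Boolean function. -/
def walsh (g : Vec m → ZMod 2) (a : Vec m) : ℤ :=
  ∑ x : Vec m, (-1 : ℤ) ^ (g x + ∑ i, a i * x i).val

/-- The linearity of `f`: the maximal absolute Walsh coefficient over all `a` and all `b ≠ 0`. -/
def lin (f : Vec m → Vec m) : ℕ :=
  (Finset.univ.filter (fun p : Vec m × Vec m => p.2 ≠ 0)).sup
    (fun p => (walsh (component f p.2) p.1).natAbs)

/-- The indicator vector of a set of coordinates. -/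
def indicator (J : Finset (Fin m)) : Vec m := fun i => if i ∈ J then 1 else 0

/-- The coefficient of the monomial `∏ i ∈ I, x i` in the algebraic normal form of `g`. That these
are the coefficients is `eq_sum_anfCoeff` (existence) and `eq_anfCoeff` (uniqueness). -/
def anfCoeff (g : Vec m → ZMod 2) (I : Finset (Fin m)) : ZMod 2 :=
  ∑ J ∈ I.powerset, g (indicator J)

theorem sum_powerset_sum_powerset (h : Finset (Fin m) → ZMod 2) (I : Finset (Fin m)) :
    ∑ K ∈ I.powerset, ∑ J ∈ K.powerset, h J = h I := by
  induction I using Finset.induction_on generalizing h with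
  | empty => simp
  | insert a s ha ih =>
    rw [Finset.sum_powerset_insert ha]
    have key : ∀ K ∈ s.powerset, ∑ J ∈ (insert a K).powerset, h J =
        ∑ J ∈ K.powerset, h J + ∑ J ∈ K.powerset, h (insert a J) := by
      intro K hK
      exact Finset.sum_powerset_insert (fun hh => ha (Finset.mem_powerset.1 hK hh)) h
    rw [Finset.sum_congr rfl key, Finset.sum_add_distrib, ← add_assoc,
      CharTwo.add_self_eq_zero, zero_add]
    exact ih (fun J => h (insert a J))

theorem prod_indicator (I J : Finset (Fin m)) :
    ∏ i ∈ I, indicator J i = if I ⊆ J then 1 else 0 := by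
  simp only [indicator]
  rw [Finset.prod_ite_zero]
  simp [Finset.subset_iff]

theorem sum_anf_indicator (c : Finset (Fin m) → ZMod 2) (J : Finset (Fin m)) :
    ∑ I : Finset (Fin m), c I * ∏ i ∈ I, indicator J i = ∑ I ∈ J.powerset, c I := by
  simp only [prod_indicator, mul_ite, mul_one, mul_zero]
  rw [← Finset.sum_filter]
  congr 1
  ext I
  simp

theorem eq_sum_anfCoeff (g : Vec m → ZMod 2) (x : Vec m) :
    g x = ∑ I : Finset (Fin m), anfCoeff g I * ∏ i ∈ I, x i := by
  have hx : x = indicator (Finset.univ.filter (fun i => x i = 1)) := by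
    funext i
    have h2 : ∀ z : ZMod 2, z = if z = 1 then 1 else 0 := by decide
    simpa [indicator] using h2 (x i)
  rw [hx, sum_anf_indicator]
  exact (sum_powerset_sum_powerset (fun J => g (indicator J)) _).symm

theorem eq_anfCoeff (g : Vec m → ZMod 2) (c : Finset (Fin m) → ZMod 2)
    (hc : ∀ x, g x = ∑ I : Finset (Fin m), c I * ∏ i ∈ I, x i) : c = anfCoeff g := by
  funext I
  simp only [anfCoeff, hc, sum_anf_indicator]
  exact (sum_powerset_sum_powerset c I).symm

/-- The algebraic degree: the largest size of a monomial occurring in the algebraic normal form;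
constants (the zero function included) have degree `0`. -/
def degree (g : Vec m → ZMod 2) : ℕ :=
  (Finset.univ.filter (fun I : Finset (Fin m) => anfCoeff g I ≠ 0)).sup Finset.card

/-- The number of nonzero `v` whose component `⟨f, v⟩` has degree `i`. -/
def numComponents (i : ℕ) (f : Vec m → Vec m) : ℕ :=
  (Finset.univ.filter (fun v : Vec m => v ≠ 0 ∧ degree (component f v) = i)).card

end SBox

/-! Suppose that some derivative of `f`, in direction `u`, takes at most four values. Differential
uniformity forces exactly four, and none is zero because `f` is injective. Up to a linear
automorphism, four distinct nonzero vectors are `1, 2, 4, t` in binary notation, where `t` is `3`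
(three of them sum to zero), `7` (all four sum to zero) or `8` (independent). The hypotheses are
invariant under affine changes on both sides, so one may take `f 0 = 0`, `u = 1`, `f 1 = 1`, and
choose the other basis vectors of the domain greedily to make their images as small as possible.

What remains is a finite backtracking search for each `t`. It prunes on injectivity and on three
pairs with the same difference and image difference. Every complete function it reaches has two
components of degree below `3` or a Walsh coefficient above `8`, contrary to the hypotheses.
`Resistant` carries the invariant hypotheses, `Admissible` the normalized functions;
`Admissible.search_eq_false` shows that no admissible function escapes the search, and
`Resistant.deriv_ne` normalizes the domain. -/

namespace SBox

/-! ### The backtracking search -/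

/-- The parity of the number of ones among the binary digits of `n < 16`. -/
def parity (n : ℕ) : Bool := Nat.testBit 27030 n

/-- Processes the pairs formed by the new point `(n, v)` and the points of a list. The bits of `D₁`
and `D₂` mark the keys `16 * (x ^^^ y) + (F x ^^^ F y)` that occurred at least once and at least
twice; a third occurrence ends the branch. -/
noncomputable def addPairs (n v : ℕ) (k : ℕ → ℕ → Bool) (l : List (ℕ × ℕ)) : ℕ → ℕ → Bool :=
  -- Recursors and binary `Nat` operations keep kernel evaluation cheap. `Bool.rec` lists the
  -- `false` case first, so a failed test returns `true`: the branch holds vacuously.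
  List.rec k (fun q _ r D₁ D₂ =>
    (fun bit => Bool.rec true (r (Nat.lor D₁ bit) (Nat.lor D₂ (Nat.land D₁ bit)))
      (Nat.beq (Nat.land D₂ bit) 0))
      (Nat.pow 2 (Nat.add (Nat.mul 16 (Nat.xor n q.1)) (Nat.xor v q.2)))) l

/-- The values the search tries at the point `n`. -/
def candidates (t n : ℕ) (used : ℕ) (l : List (ℕ × ℕ)) : List ℕ :=
  if Nat.testBit n 0 then
    match l with
    | [] => []
    | q :: _ => [Nat.xor q.2 1, Nat.xor q.2 2, Nat.xor q.2 4, Nat.xor q.2 t]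
  else if Nat.land n (n - 1) = 0 then
    ((List.range 16).filter fun v => !Nat.testBit used v).take 1
  else [0,1,2,3,4,5,6,7,8,9,10,11,12,13,14,15]

/-- The vector `∑ x, ⟨b, F x⟩ • x`, for a function given by the list of its values. -/
def moment (b : ℕ) (l : List (ℕ × ℕ)) : ℕ :=
  l.foldr (fun q s => if parity (Nat.land b q.2) then Nat.xor q.1 s else s) 0

/-- The Walsh coefficient of `⟨b, F x⟩` at `a` exceeds `8` in absolute value. -/
def unbalanced (b a : ℕ) (l : List (ℕ × ℕ)) : Bool :=
  let c := l.countP fun q => parity (Nat.xor (Nat.land b q.2) (Nat.land a q.1))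
  decide (c < 4) || decide (12 < c)

/-- Two components are quadratic, or a Walsh coefficient is too large. -/
def leaf (l : List (ℕ × ℕ)) : Bool :=
  -- For `t = 3` or `7`, bit `3` of the derivative vanishes, so component `8` is constant on the
  -- pairs `{x, x + 1}`. Being balanced, it is `1` on four of them, and its moment is zero. A second
  -- zero moment is then forbidden.
  (moment 8 l == 0 && (moment 7 l == 0 || moment 1 l == 0 || moment 2 l == 0 || moment 3 l == 0))
  || (List.range 16).any fun a => [5,6,7,13,14,15].any fun b => unbalanced b a l

/-- Whether `leaf` holds for every extension by `k` values of the values below `n` listed in `l`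
that is compatible with `candidates`, injectivity (`used` marks the values taken) and `addPairs`. -/
noncomputable def search (t : ℕ) (k : ℕ) : ℕ → List (ℕ × ℕ) → ℕ → ℕ → ℕ → Bool :=
  Nat.rec (fun _ l _ _ _ => leaf l) (fun _ r n l used D₁ D₂ =>
     List.rec true (fun v _ s => Bool.rec false s (
       (fun bit => Bool.rec true
         (addPairs n v (r (Nat.succ n) ((n, v) :: l) (Nat.lor used bit)) l D₁ D₂)
       (Nat.beq (Nat.land used bit) 0)) (Nat.pow 2 v)))
     (candidates t n used l)) k

/-- The values of `F` on the numbers below `n`, latest first. -/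
def prefixList (F : ℕ → ℕ) : ℕ → List (ℕ × ℕ)
  | 0 => []
  | n + 1 => (n, F n) :: prefixList F n

/-- The direction `e.1 ^^^ e.2` together with the value of the derivative of `F` there. -/
def key (F : ℕ → ℕ) (e : ℕ × ℕ) : ℕ := 16 * (e.1 ^^^ e.2) + (F e.1 ^^^ F e.2)

/-! ### Soundness of the search -/

/-- The normalized functions among which the search looks for one whose leaf test fails. -/
structure Admissible (t : ℕ) (F : ℕ → ℕ) : Prop where
  lt : ∀ x < 16, F x < 16
  inj : ∀ x < 16, ∀ y < 16, F x = F y → x = y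
  zero : F 0 = 0
  one : F 1 = 1
  step : ∀ x < 15, x % 2 = 0 →
    F (x + 1) ∈ [F x ^^^ 1, F x ^^^ 2, F x ^^^ 4, F x ^^^ t]
  least : ∀ n ∈ [2, 4, 8], ∀ w < F n, ∃ y < n, F y = w
  diff : ∀ e₁ e₂ e₃ : ℕ × ℕ, e₁.2 < e₁.1 → e₁.1 < 16 → e₂.2 < e₂.1 → e₂.1 < 16 →
    e₃.2 < e₃.1 → e₃.1 < 16 → key F e₁ = key F e₂ → key F e₁ = key F e₃ →
    e₁ = e₂ ∨ e₁ = e₃ ∨ e₂ = e₃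

/-- `D₁` and `D₂` mark keys that occur at least once and at least twice in `S`. -/
def Marks (F : ℕ → ℕ) (S : Set (ℕ × ℕ)) (D₁ D₂ : ℕ) : Prop :=
  (∀ p, D₁.testBit p → ∃ e ∈ S, key F e = p) ∧
  ∀ p, D₂.testBit p → ∃ e ∈ S, ∃ e' ∈ S, e ≠ e' ∧ key F e = p ∧ key F e' = p

theorem Marks.mono {F : ℕ → ℕ} {S T : Set (ℕ × ℕ)} {D₁ D₂ : ℕ} (h : Marks F S D₁ D₂)
    (hST : S ⊆ T) : Marks F T D₁ D₂ := by
  refine ⟨fun p hp => ?_, fun p hp => ?_⟩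
  · obtain ⟨e, he, h1⟩ := h.1 p hp
    exact ⟨e, hST he, h1⟩
  · obtain ⟨e, he, e', he', h1⟩ := h.2 p hp
    exact ⟨e, hST he, e', hST he', h1⟩

theorem Marks.insert {F : ℕ → ℕ} {S : Set (ℕ × ℕ)} {D₁ D₂ : ℕ} (h : Marks F S D₁ D₂)
    {e : ℕ × ℕ} (he : e ∉ S) :
    Marks F (insert e S) (D₁ ||| 2 ^ key F e) (D₂ ||| (D₁ &&& 2 ^ key F e)) := by
  refine ⟨fun p hp => ?_, fun p hp => ?_⟩
  · rw [Nat.testBit_or, Bool.or_eq_true, Nat.testBit_two_pow] at hp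
    rcases hp with hp | hp
    · obtain ⟨e', he', h1⟩ := h.1 p hp
      exact ⟨e', Set.mem_insert_of_mem _ he', h1⟩
    · exact ⟨e, Set.mem_insert _ _, of_decide_eq_true hp⟩
  · rw [Nat.testBit_or, Bool.or_eq_true, Nat.testBit_and, Bool.and_eq_true,
      Nat.testBit_two_pow] at hp
    rcases hp with hp | ⟨hp, hq⟩
    · obtain ⟨e₁, he₁, e₂, he₂, h1⟩ := h.2 p hp
      exact ⟨e₁, Set.mem_insert_of_mem _ he₁, e₂, Set.mem_insert_of_mem _ he₂, h1⟩
    · obtain ⟨e', he', h1⟩ := h.1 p hp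
      refine ⟨e', Set.mem_insert_of_mem _ he', e, Set.mem_insert _ _, ?_, h1,
        of_decide_eq_true hq⟩
      rintro rfl
      exact he he'

/-- The pairs among the points below `n`, and those formed by `n` and a point from `m` on. -/
def pairsUpTo (n m : ℕ) : Set (ℕ × ℕ) := {e | e.2 < e.1 ∧ (e.1 < n ∨ e.1 = n ∧ m ≤ e.2)}

/-- Pruning never removes `F` itself: a bit of `D₂` at the new key would yield two earlier pairs
with that key, hence three in all, against `Admissible.diff`. -/
theorem addPairs_eq_false {t : ℕ} {F : ℕ → ℕ} (hF : Admissible t F) {n : ℕ} (hn : n < 16)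
    {k : ℕ → ℕ → Bool} (hk : ∀ D₁ D₂, Marks F (pairsUpTo (n + 1) (n + 1)) D₁ D₂ → k D₁ D₂ = false)
    (m : ℕ) (hm : m ≤ n) (D₁ D₂ : ℕ) (hD : Marks F (pairsUpTo n m) D₁ D₂) :
    addPairs n (F n) k (prefixList F m) D₁ D₂ = false := by
  induction m generalizing D₁ D₂ with
  | zero =>
    refine hk _ _ (hD.mono ?_)
    rintro e ⟨h1, h2⟩
    exact ⟨h1, by omega⟩
  | succ m ih =>
    have hne : (n, m) ∉ pairsUpTo n (m + 1) := by
      rintro ⟨h1, h2⟩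
      simp at h2
    have hbit : D₂ &&& 2 ^ key F (n, m) = 0 := by
      rw [Nat.and_two_pow]
      by_cases hb : D₂.testBit (key F (n, m))
      · exfalso
        obtain ⟨e, he, e', he', hee, h1, h2⟩ := hD.2 _ hb
        have he2 := he.2
        have he2' := he'.2
        rcases hF.diff e e' (n, m) he.1 (by omega) he'.1 (by omega) (by simpa using hm) hn
          (h1.trans h2.symm) h1 with h | h | h
        · exact hee h
        · exact hne (h ▸ he)
        · exact hne (h ▸ he')
      · simp [hb]
    have hstep : addPairs n (F n) k (prefixList F (m + 1)) D₁ D₂ =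
        Bool.rec true (addPairs n (F n) k (prefixList F m) (D₁ ||| 2 ^ key F (n, m))
          (D₂ ||| (D₁ &&& 2 ^ key F (n, m)))) (Nat.beq (D₂ &&& 2 ^ key F (n, m)) 0) := rfl
    rw [hstep, hbit]
    refine ih (by omega) _ _ ((hD.insert hne).mono ?_)
    rintro e (rfl | ⟨h1, h2⟩)
    · exact ⟨by simpa using hm, by simp⟩
    · exact ⟨h1, by omega⟩

theorem mem_candidates {t : ℕ} {F : ℕ → ℕ} (hF : Admissible t F) {n used : ℕ} (hn : n < 16)
    (hn2 : 2 ≤ n) (hused : ∀ v, used.testBit v ↔ ∃ y < n, F y = v) :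
    F n ∈ candidates t n used (prefixList F n) := by
  have hnot : used.testBit (F n) = false := by
    by_contra h
    obtain ⟨y, hy, h1⟩ := (hused _).1 (by simpa using h)
    exact hy.ne (hF.inj y (by omega) n hn h1)
  have hlt := hF.lt n hn
  unfold candidates
  split_ifs with h1 h2
  · obtain ⟨m, rfl⟩ : ∃ m, n = m + 1 := ⟨n - 1, by omega⟩
    rw [Nat.testBit_zero] at h1
    exact hF.step m (by omega) (by simp at h1; omega)
  · have hmem : n ∈ [2, 4, 8] := by
      revert h2; revert hn2; clear hused hnot hlt h1
      revert n; decide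
    -- All values below `F n` are used by minimality, so `F n` is the first one to survive the
    -- filter.
    have hsplit : List.range 16 = List.range (F n) ++ List.range' (F n) (16 - F n) := by
      have := List.range'_append_1 (s := 0) (m := F n) (n := 16 - F n)
      rw [Nat.zero_add, Nat.add_sub_cancel' hlt.le] at this
      rw [List.range_eq_range', List.range_eq_range', this]
    have h0 : ((List.range (F n)).filter fun v => !Nat.testBit used v) = [] := by
      rw [List.filter_eq_nil_iff]
      intro w hw
      simp [(hused w).2 (hF.least n hmem w (List.mem_range.1 hw))]
    obtain ⟨j, hj⟩ : ∃ j, 16 - F n = j + 1 := ⟨15 - F n, by omega⟩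
    rw [hsplit, List.filter_append, h0, hj, List.range'_succ, List.filter_cons]
    simp [hnot]
  · clear h1 h2 hnot hused
    generalize F n = v at hlt
    interval_cases v <;> decide

/-- The outer `Bool.rec` is a conjunction over the candidates, so one unused candidate with value
`false` decides it. -/
theorem rec_candidates {used : ℕ} {g : ℕ → ℕ → Bool} {c : List ℕ} {v : ℕ} (hv : v ∈ c)
    (hused : used.testBit v = false) (hg : g v (2 ^ v) = false) :
    (List.rec true (fun v _ s => Bool.rec false s (
       (fun bit => Bool.rec true (g v bit)
       (Nat.beq (Nat.land used bit) 0)) (Nat.pow 2 v))) c : Bool) = false := by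
  induction c with
  | nil => simp at hv
  | cons a c ih =>
    rcases List.mem_cons.1 hv with rfl | hv
    · have h0 : Nat.land used (Nat.pow 2 v) = 0 := by
        change used &&& 2 ^ v = 0
        rw [Nat.and_two_pow, hused]; simp
      have hg' : g v (Nat.pow 2 v) = false := hg
      simp only [h0, hg']
      rfl
    · have h1 := ih hv
      dsimp only at h1 ⊢
      rw [h1]
      generalize (Bool.rec true _ _ : Bool) = b
      cases b <;> rfl

theorem search_eq_false {t : ℕ} {F : ℕ → ℕ} (hF : Admissible t F)
    (hleaf : leaf (prefixList F 16) = false) (k n : ℕ) (hnk : n + k = 16) (hn2 : 2 ≤ n)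
    (used D₁ D₂ : ℕ) (hused : ∀ v, used.testBit v ↔ ∃ y < n, F y = v)
    (hD : Marks F (pairsUpTo n n) D₁ D₂) :
    search t k n (prefixList F n) used D₁ D₂ = false := by
  induction k generalizing n used D₁ D₂ with
  | zero =>
    obtain rfl : n = 16 := by omega
    exact hleaf
  | succ k ih =>
    have hn : n < 16 := by omega
    have hnot : used.testBit (F n) = false := by
      by_contra h
      obtain ⟨y, hy, h1⟩ := (hused _).1 (by simpa using h)
      exact hy.ne (hF.inj y (by omega) n hn h1)
    refine rec_candidates (g := fun v bit => addPairs n v (search t k (Nat.succ n)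
      ((n, v) :: prefixList F n) (Nat.lor used bit)) (prefixList F n) D₁ D₂)
      (mem_candidates hF hn hn2 hused) hnot ?_
    refine addPairs_eq_false hF hn (fun D₁' D₂' hD' => ?_) n le_rfl D₁ D₂ hD
    refine ih (n + 1) (by omega) (by omega) _ _ _ (fun v => ?_) hD'
    change (used ||| 2 ^ F n).testBit v ↔ _
    rw [Nat.testBit_or, Bool.or_eq_true, hused, Nat.testBit_two_pow, decide_eq_true_iff]
    constructor
    · rintro (⟨y, hy, h1⟩ | h1)
      · exact ⟨y, by omega, h1⟩
      · exact ⟨n, by omega, h1⟩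
    · rintro ⟨y, hy, h1⟩
      rcases Nat.lt_succ_iff_lt_or_eq.1 hy with h | rfl
      · exact Or.inl ⟨y, h, h1⟩
      · exact Or.inr h1

/-- In the start state, `3` marks the values `0` and `1`, and the only pair `(1, 0)` has key `16 * 1
+ 1 = 17`. -/
theorem Admissible.search_eq_false {t : ℕ} {F : ℕ → ℕ} (hF : Admissible t F)
    (hleaf : leaf (prefixList F 16) = false) :
    search t 14 2 [(1, 1), (0, 0)] 3 (2 ^ 17) 0 = false := by
  have hlist : prefixList F 2 = [(1, 1), (0, 0)] := by simp [prefixList, hF.zero, hF.one]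
  rw [← hlist]
  refine SBox.search_eq_false hF hleaf 14 2 rfl le_rfl _ _ _ (fun v => ?_) ⟨fun p hp => ?_, ?_⟩
  · have h3 : Nat.testBit 3 v = true ↔ v = 0 ∨ v = 1 := by
      rcases v with _ | _ | v
      · decide
      · decide
      · simp [Nat.testBit_add_one]
    rw [h3]
    constructor
    · rintro (rfl | rfl)
      · exact ⟨0, by omega, hF.zero⟩
      · exact ⟨1, by omega, hF.one⟩
    · rintro ⟨y, hy, rfl⟩
      interval_cases y
      · exact Or.inl hF.zero
      · exact Or.inr hF.one
  · rw [Nat.testBit_two_pow, decide_eq_true_iff] at hp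
    refine ⟨(1, 0), ⟨by simp, by simp⟩, ?_⟩
    simp [key, hF.zero, hF.one, ← hp]
  · simp

/-! ### The three exhaustive computations -/

set_option maxRecDepth 100000 in
theorem search_three : search 3 14 2 [(1, 1), (0, 0)] 3 (2 ^ 17) 0 = true := by
  decide +kernel

set_option maxRecDepth 100000 in
theorem search_seven : search 7 14 2 [(1, 1), (0, 0)] 3 (2 ^ 17) 0 = true := by
  decide +kernel

set_option maxRecDepth 100000 in
theorem search_eight : search 8 14 2 [(1, 1), (0, 0)] 3 (2 ^ 17) 0 = true := by
  decide +kernel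

theorem Admissible.leaf_prefixList {t : ℕ} {F : ℕ → ℕ} (hF : Admissible t F)
    (ht : t = 3 ∨ t = 7 ∨ t = 8) : leaf (prefixList F 16) = true := by
  by_contra h
  have h1 := hF.search_eq_false (by simpa using h)
  rcases ht with rfl | rfl | rfl
  · exact Bool.noConfusion (search_three.symm.trans h1)
  · exact Bool.noConfusion (search_seven.symm.trans h1)
  · exact Bool.noConfusion (search_eight.symm.trans h1)

/-! ### Affine invariance of the hypotheses -/

/-- The coordinate-free form of the hypotheses: injectivity, differential uniformity, at most one
nonzero component of degree less than `3`, and linearity at most `8`. -/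
structure Resistant (f : Vec 4 → Vec 4) : Prop where
  inj : Function.Injective f
  diff : DifferentiallyUniform 4 f
  moment : ∀ φ ψ : Module.Dual (ZMod 2) (Vec 4), φ ≠ 0 → ψ ≠ 0 → ∑ x, φ (f x) • x = 0 →
    ∑ x, ψ (f x) • x = 0 → φ = ψ
  walsh : ∀ φ ψ : Module.Dual (ZMod 2) (Vec 4), φ ≠ 0 → ∀ c : ZMod 2,
    (Finset.univ.filter fun x => φ (f x) + ψ x = c).card ≤ 12

theorem sum_univ_vec : ∑ x : Vec 4, x = 0 := by decide

theorem sum_apply_eq_zero {f : Vec 4 → Vec 4} (hf : Function.Injective f)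
    (φ : Module.Dual (ZMod 2) (Vec 4)) : ∑ x, φ (f x) = 0 := by
  have h := (Equiv.ofBijective f (Finite.injective_iff_bijective.1 hf)).sum_comp fun x => φ x
  exact h.trans (by rw [← map_sum, sum_univ_vec, map_zero])

theorem add_self_vec {m : ℕ} (x : Vec m) : x + x = 0 := by
  funext i
  exact CharTwo.add_self_eq_zero _

theorem add_eq_iff_vec {m : ℕ} {x y z : Vec m} : x + y = z ↔ x = z + y := by
  constructor
  · rintro rfl
    rw [add_assoc, add_self_vec, add_zero]
  · rintro rfl
    rw [add_assoc, add_self_vec, add_zero]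

/-- Functionals pull back along `M`. The translation adds a multiple of `∑ x, x = 0` to the moments
and only shifts the constant in the Walsh condition. -/
theorem Resistant.comp_left {f : Vec 4 → Vec 4} (hf : Resistant f)
    (M : Vec 4 ≃ₗ[ZMod 2] Vec 4) (c : Vec 4) : Resistant fun x => M (f x + c) := by
  have hdual : ∀ φ : Module.Dual (ZMod 2) (Vec 4), φ ≠ 0 → φ ∘ₗ M.toLinearMap ≠ 0 := by
    intro φ hφ h
    refine hφ (LinearMap.ext fun x => ?_)
    simpa using LinearMap.congr_fun h (M.symm x)
  have hmom : ∀ φ : Module.Dual (ZMod 2) (Vec 4), ∑ x, φ (M (f x + c)) • x =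
      ∑ x, (φ ∘ₗ M.toLinearMap) (f x) • x := by
    intro φ
    simp only [map_add, add_smul, Finset.sum_add_distrib, LinearMap.comp_apply,
      LinearEquiv.coe_coe]
    rw [← Finset.smul_sum, sum_univ_vec, smul_zero, add_zero]
  refine ⟨fun x y h => hf.inj (add_right_cancel (M.injective h)), fun u hu v => ?_, ?_, ?_⟩
  · refine le_of_eq_of_le (congrArg Finset.card (Finset.filter_congr fun x _ => ?_))
      (hf.diff u hu (M.symm v))
    rw [deriv, ← map_add, M.eq_symm_apply, deriv, add_add_add_comm, add_self_vec, add_zero]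
  · intro φ ψ hφ hψ h1 h2
    have h := hf.moment _ _ (hdual φ hφ) (hdual ψ hψ) ((hmom φ).symm.trans h1)
      ((hmom ψ).symm.trans h2)
    refine LinearMap.ext fun x => ?_
    simpa using LinearMap.congr_fun h (M.symm x)
  · intro φ ψ hφ d
    refine le_of_eq_of_le (congrArg Finset.card (Finset.filter_congr fun x _ => ?_))
      (hf.walsh _ ψ (hdual φ hφ) (d - φ (M c)))
    rw [map_add, map_add, eq_sub_iff_add_eq, LinearMap.comp_apply, LinearEquiv.coe_coe,
      add_right_comm]

/-- Substitution transports moments by `L`; the translation contributes `∑ x, φ (f x)` times a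
vector, which is zero for a permutation. -/
theorem Resistant.comp_right {f : Vec 4 → Vec 4} (hf : Resistant f)
    (L : Vec 4 ≃ₗ[ZMod 2] Vec 4) (c : Vec 4) : Resistant fun x => f (L x + c) := by
  let e : Vec 4 ≃ Vec 4 := L.toEquiv.trans (Equiv.addRight c)
  have he : ∀ x, e x = L x + c := fun _ => rfl
  have hmom : ∀ φ : Module.Dual (ZMod 2) (Vec 4), L (∑ x, φ (f (L x + c)) • x) =
      ∑ x, φ (f x) • x := by
    intro φ
    rw [← e.sum_comp fun x => φ (f x) • x, map_sum]
    simp only [he, smul_add, Finset.sum_add_distrib, ← Finset.sum_smul, map_smul]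
    have h : ∑ x, φ (f (L x + c)) = 0 :=
      sum_apply_eq_zero (f := fun x => f (e x)) (hf.inj.comp e.injective) φ
    rw [h, zero_smul, add_zero]
  refine ⟨hf.inj.comp e.injective, fun u hu v => ?_, ?_, ?_⟩
  · refine le_of_eq_of_le (Finset.card_equiv e fun x => ?_)
      (hf.diff (L u) (by simpa using hu) v)
    rw [Finset.mem_filter_univ, Finset.mem_filter_univ, deriv, deriv, he, map_add, add_right_comm]
  · intro φ ψ hφ hψ h1 h2
    exact hf.moment φ ψ hφ hψ (by rw [← hmom, h1, map_zero]) (by rw [← hmom, h2, map_zero])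
  · intro φ ψ hφ d
    refine le_of_eq_of_le (Finset.card_equiv e fun x => ?_)
      (hf.walsh φ (ψ ∘ₗ L.symm.toLinearMap) hφ (d + ψ (L.symm c)))
    simp only [Finset.mem_filter, Finset.mem_univ, true_and, he, LinearMap.comp_apply,
      LinearEquiv.coe_coe, map_add, LinearEquiv.symm_apply_apply]
    rw [← add_assoc, add_left_inj]

/-! ### Walsh coefficients and degree in terms of functionals -/

theorem dual_apply_eq_sum (φ : Module.Dual (ZMod 2) (Vec 4)) (x : Vec 4) :
    φ x = ∑ i, x i * φ (Pi.single i 1) := by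
  refine (LinearMap.pi_apply_eq_sum_univ φ x).trans (Finset.sum_congr rfl fun i _ => ?_)
  rw [smul_eq_mul]
  congr 2
  funext j
  simp [Pi.single_apply, eq_comm]

/-- If the value `c` is taken `k` times, the Walsh coefficient is `±(2k - 16)`. -/
theorem card_le_of_walsh_le {g : Vec 4 → ZMod 2} {a : Vec 4} (h : (walsh g a).natAbs ≤ 8)
    (c : ZMod 2) : (Finset.univ.filter fun x => g x + ∑ i, a i * x i = c).card ≤ 12 := by
  have h1 : ∀ z : ZMod 2, (-1 : ℤ) ^ z.val = if z = c then (-1) ^ c.val else -(-1) ^ c.val := by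
    revert c; decide
  have h2 : walsh g a = ∑ x : Vec 4, if g x + ∑ i, a i * x i = c then
      (-1 : ℤ) ^ c.val else -(-1) ^ c.val := Finset.sum_congr rfl fun x _ => h1 _
  rw [Finset.sum_ite, Finset.sum_const, Finset.sum_const, Finset.filter_not,
    Finset.card_sdiff_of_subset (Finset.filter_subset _ _)] at h2
  have h3 : (Finset.univ.filter fun x => g x + ∑ i, a i * x i = c).card ≤ 16 :=
    (Finset.card_le_univ _).trans (by simp [ZMod.card])
  have h4 : (Finset.univ : Finset (Vec 4)).card = 16 := by simp [ZMod.card]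
  rw [h4] at h2
  generalize (Finset.univ.filter fun x => g x + ∑ i, a i * x i = c).card = k at *
  have h5 : ((16 - k : ℕ) : ℤ) = 16 - k := by omega
  rw [nsmul_eq_mul, nsmul_eq_mul, h5] at h2
  rcases neg_one_pow_eq_or ℤ c.val with h6 | h6 <;> rw [h6] at h2 <;> omega

/-- The coefficient sums `g` over the vectors with `x i = 0`, and `1 + x i` is the indicator
function of that set. -/
theorem anfCoeff_compl_singleton (g : Vec 4 → ZMod 2) (i : Fin 4) :
    anfCoeff g {i}ᶜ = ∑ x, g x * (1 + x i) := by
  have h2 : ∀ z : ZMod 2, z ≠ 1 → z = 0 := by decide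
  have h3 : ∑ x, g x * (1 + x i) = ∑ x ∈ Finset.univ.filter (fun x : Vec 4 => x i = 0), g x := by
    rw [Finset.sum_filter]
    refine Finset.sum_congr rfl fun x _ => ?_
    split_ifs with h
    · rw [h, add_zero, mul_one]
    · have : ∀ z : ZMod 2, z ≠ 0 → 1 + z = 0 := by decide
      rw [this _ h, mul_zero]
  rw [h3, anfCoeff]
  refine Finset.sum_nbij' indicator (fun x => Finset.univ.filter fun j => x j = 1) ?_ ?_ ?_ ?_ ?_
  · intro J hJ
    have : i ∉ J := fun h => by simpa using Finset.mem_powerset.1 hJ h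
    simp [indicator, this]
  · intro x hx
    have hx : x i = 0 := by simpa using hx
    rw [Finset.mem_powerset]
    intro j hj
    rw [Finset.mem_compl, Finset.mem_singleton]
    rintro rfl
    simp [hx] at hj
  · intro J _
    ext j
    simp [indicator]
  · intro x _
    funext j
    by_cases h : x j = 1
    · simp [indicator, h]
    · simp [indicator, h2 _ h]
  · intro J _
    rfl

/-- A cubic monomial omits one variable `x i`, so its coefficient is `∑ g x + ∑ g x * x i`; both
sums vanish. -/
theorem degree_ne_three {g : Vec 4 → ZMod 2} (h0 : ∑ x, g x = 0)
    (h1 : ∑ x, g x • x = (0 : Vec 4)) : degree g ≠ 3 := by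
  intro h
  have hne : (Finset.univ.filter fun I : Finset (Fin 4) => anfCoeff g I ≠ 0).Nonempty := by
    by_contra hempty
    rw [degree, Finset.not_nonempty_iff_eq_empty.1 hempty] at h
    simp at h
  obtain ⟨I, hI, h2⟩ := Finset.exists_mem_eq_sup _ hne Finset.card
  have hcard : Iᶜ.card = 1 := by
    rw [Finset.card_compl, ← h2]
    change _ - degree g = 1
    rw [h]; rfl
  obtain ⟨i, hi⟩ := Finset.card_eq_one.1 hcard
  refine (Finset.mem_filter.1 hI).2 ?_
  rw [← compl_compl I, hi, anfCoeff_compl_singleton]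
  have h3 := congrFun h1 i
  simp only [Finset.sum_apply, Pi.smul_apply, smul_eq_mul, Pi.zero_apply] at h3
  simp only [mul_add, mul_one, Finset.sum_add_distrib, h0, h3, add_zero]

theorem resistant_of_lin {f : Vec 4 → Vec 4} (hf : Function.Injective f) (hlin : lin f ≤ 8)
    (hdiff : DifferentiallyUniform 4 f) (hdeg : 14 ≤ numComponents 3 f) : Resistant f := by
  let vec : Module.Dual (ZMod 2) (Vec 4) → Vec 4 := fun φ i => φ (Pi.single i 1)
  have hvec : Function.Injective vec := by
    intro φ ψ h
    refine LinearMap.ext fun x => ?_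
    rw [dual_apply_eq_sum, dual_apply_eq_sum]
    exact Finset.sum_congr rfl fun i _ => congrArg _ (congrFun h i)
  have hvec0 : ∀ φ, φ ≠ 0 → vec φ ≠ 0 := by
    intro φ hφ h
    exact hφ (hvec (h.trans (by funext i; simp [vec])))
  have hcomp : ∀ φ, component f (vec φ) = fun x => φ (f x) := by
    intro φ
    funext x
    exact (dual_apply_eq_sum φ (f x)).symm
  refine ⟨hf, hdiff, fun φ ψ hφ hψ h1 h2 => ?_, fun φ ψ hφ c => ?_⟩
  · by_contra hne
    have hdegree : ∀ φ : Module.Dual (ZMod 2) (Vec 4), ∑ x, φ (f x) • x = 0 →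
        degree (component f (vec φ)) ≠ 3 := by
      intro φ h
      rw [hcomp]
      exact degree_ne_three (sum_apply_eq_zero hf φ) h
    have hsub : (Finset.univ.filter fun v : Vec 4 => v ≠ 0 ∧ degree (component f v) = 3) ⊆
        ({0, vec φ, vec ψ} : Finset (Vec 4))ᶜ := by
      intro v hv
      obtain ⟨-, hv0, hv3⟩ := Finset.mem_filter.1 hv
      rw [Finset.mem_compl, Finset.mem_insert, Finset.mem_insert, Finset.mem_singleton]
      rintro (rfl | rfl | rfl)
      · exact hv0 rfl
      · exact hdegree φ h1 hv3
      · exact hdegree ψ h2 hv3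
    have hcard : ({0, vec φ, vec ψ} : Finset (Vec 4)).card = 3 :=
      Finset.card_eq_three.2 ⟨_, _, _, (hvec0 φ hφ).symm, (hvec0 ψ hψ).symm, hvec.ne hne, rfl⟩
    -- Excluding `0` and two further vectors leaves only `13` of the `16`.
    have h3 := hdeg.trans (Finset.card_le_card hsub)
    rw [Finset.card_compl, hcard] at h3
    simp [ZMod.card] at h3
  · have h1 : (walsh (component f (vec φ)) (vec ψ)).natAbs ≤ 8 := by
      refine le_trans ?_ hlin
      exact Finset.le_sup (f := fun p : Vec 4 × Vec 4 => (walsh (component f p.2) p.1).natAbs)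
        (b := (vec ψ, vec φ)) (by simpa using hvec0 φ hφ)
    refine le_of_eq_of_le (congrArg Finset.card (Finset.filter_congr fun x _ => ?_))
      (card_le_of_walsh_le h1 c)
    rw [hcomp, dual_apply_eq_sum ψ]
    simp only [mul_comm, vec]

/-! ### Vectors as numbers below 16 -/

/-- The vector of the binary digits of `n`. -/
def dec (n : ℕ) : Vec 4 := fun i => if n.testBit i then 1 else 0

/-- The number whose binary digits are the coordinates of `x`. -/
def code (x : Vec 4) : ℕ := ∑ i : Fin 4, 2 ^ (i : ℕ) * (x i).val

theorem code_dec {n : ℕ} (hn : n < 16) : code (dec n) = n := by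
  revert n; decide

theorem dec_code (x : Vec 4) : dec (code x) = x := by
  revert x; decide

theorem code_lt (x : Vec 4) : code x < 16 := by
  revert x; decide

theorem code_injective : Function.Injective code := Function.LeftInverse.injective dec_code

theorem dec_xor (m n : ℕ) : dec (m ^^^ n) = dec m + dec n := by
  funext i
  simp only [dec, Nat.testBit_xor, Pi.add_apply]
  cases m.testBit i <;> cases n.testBit i <;> decide

theorem dec_zero : dec 0 = 0 := by decide

theorem xor_lt_sixteen {m n : ℕ} (hm : m < 16) (hn : n < 16) : m ^^^ n < 16 :=
  Nat.xor_lt_two_pow (n := 4) hm hn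

theorem dec_inj {m n : ℕ} (hm : m < 16) (hn : n < 16) (h : dec m = dec n) : m = n := by
  rw [← code_dec hm, h, code_dec hn]

theorem code_add (x y : Vec 4) : code (x + y) = code x ^^^ code y := by
  refine dec_inj (code_lt _) (xor_lt_sixteen (code_lt _) (code_lt _)) ?_
  rw [dec_xor, dec_code, dec_code, dec_code]

/-- The functional `x ↦ ∑ i, a i * x i`. -/
def dotDual (a : Vec 4) : Module.Dual (ZMod 2) (Vec 4) := ∑ i, a i • LinearMap.proj i

theorem dotDual_apply (a x : Vec 4) : dotDual a x = ∑ i, a i * x i := by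
  simp [dotDual, LinearMap.sum_apply]

theorem dotDual_injective : Function.Injective dotDual := by
  intro a b h
  funext i
  simpa [dotDual_apply, Pi.single_apply] using LinearMap.congr_fun h (Pi.single i 1)

theorem dotDual_dec_ne_zero {b : ℕ} (hb : b < 16) (h0 : b ≠ 0) : dotDual (dec b) ≠ 0 := by
  intro h
  refine h0 (dec_inj hb (by omega) (dotDual_injective (h.trans ?_)))
  rw [dec_zero]
  ext
  simp [dotDual_apply]

theorem parity_and {m n : ℕ} (hm : m < 16) (hn : n < 16) :
    dotDual (dec m) (dec n) = if parity (m &&& n) then 1 else 0 := by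
  rw [dotDual_apply]
  revert n; revert m; decide

theorem parity_xor {m n : ℕ} (hm : m < 16) (hn : n < 16) :
    parity (m ^^^ n) = (parity m ^^ parity n) := by
  revert n; revert m; decide

theorem sum_range_dec {M : Type*} [AddCommMonoid M] (h : Vec 4 → M) :
    ∑ x ∈ Finset.range 16, h (dec x) = ∑ x, h x := by
  refine Finset.sum_nbij' dec code ?_ ?_ ?_ ?_ ?_
  · simp
  · exact fun x _ => Finset.mem_range.2 (code_lt x)
  · exact fun x hx => code_dec (Finset.mem_range.1 hx)
  · exact fun x _ => dec_code x
  · exact fun x _ => rfl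

/-- The function on numbers below `16` that represents `g`. -/
def encode (g : Vec 4 → Vec 4) (n : ℕ) : ℕ := code (g (dec n))

theorem dec_moment (g : Vec 4 → Vec 4) {b : ℕ} (hb : b < 16) (n : ℕ) :
    dec (moment b (prefixList (encode g) n)) =
      ∑ x ∈ Finset.range n, dotDual (dec b) (g (dec x)) • dec x := by
  induction n with
  | zero => exact dec_zero
  | succ n ih =>
    have h : moment b (prefixList (encode g) (n + 1)) =
        if parity (b &&& encode g n) then n ^^^ moment b (prefixList (encode g) n)
        else moment b (prefixList (encode g) n) := rfl
    have h2 := parity_and hb (code_lt (g (dec n)))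
    rw [dec_code] at h2
    rw [h, Finset.sum_range_succ, ← ih, h2]
    change dec (if parity (b &&& code (g (dec n))) then _ else _) = _
    split_ifs
    · rw [dec_xor, one_smul, add_comm]
    · rw [zero_smul, add_zero]

theorem countP_prefixList (p : ℕ × ℕ → Bool) (F : ℕ → ℕ) (n : ℕ) :
    (prefixList F n).countP p = ∑ x ∈ Finset.range n, if p (x, F x) then 1 else 0 := by
  induction n with
  | zero => rfl
  | succ n ih => rw [prefixList, List.countP_cons, ih, Finset.sum_range_succ]

theorem Resistant.moment_encode {g : Vec 4 → Vec 4} (hg : Resistant g) {b c : ℕ} (hb : b < 16)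
    (hc : c < 16) (hb0 : b ≠ 0) (hc0 : c ≠ 0) (hbc : b ≠ c)
    (h1 : SBox.moment b (prefixList (encode g) 16) = 0)
    (h2 : SBox.moment c (prefixList (encode g) 16) = 0) :
    False := by
  have h : ∀ b < 16, SBox.moment b (prefixList (encode g) 16) = 0 →
      ∑ x, dotDual (dec b) (g x) • x = 0 := by
    intro b hb h1
    rw [← sum_range_dec fun x => dotDual (dec b) (g x) • x, ← dec_moment g hb, h1, dec_zero]
  exact hbc (dec_inj hb hc (dotDual_injective (hg.moment _ _ (dotDual_dec_ne_zero hb hb0)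
    (dotDual_dec_ne_zero hc hc0) (h b hb h1) (h c hc h2))))

theorem Resistant.unbalanced_encode {g : Vec 4 → Vec 4} (hg : Resistant g) {b a : ℕ} (hb : b < 16)
    (ha : a < 16) (hb0 : b ≠ 0) : unbalanced b a (prefixList (encode g) 16) = false := by
  have hcount : (prefixList (encode g) 16).countP
      (fun q => parity (Nat.xor (Nat.land b q.2) (Nat.land a q.1))) =
      (Finset.univ.filter fun x => dotDual (dec b) (g x) + dotDual (dec a) x = 1).card := by
    rw [countP_prefixList, Finset.card_filter, ← sum_range_dec]
    refine Finset.sum_congr rfl fun x hx => ?_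
    have hx := Finset.mem_range.1 hx
    have h1 := parity_and hb (code_lt (g (dec x)))
    rw [dec_code] at h1
    rw [h1, parity_and ha hx]
    change (if parity ((b &&& code (g (dec x))) ^^^ (a &&& x)) then 1 else 0) = _
    rw [parity_xor (Nat.and_le_left.trans_lt hb) (Nat.and_le_left.trans_lt ha)]
    cases parity (b &&& code (g (dec x))) <;> cases parity (a &&& x) <;> decide
  -- The bound for the value `0` gives a count of at least `4`, the one for `1` a count of at most
  -- `12`.
  have h0 := hg.walsh _ (dotDual (dec a)) (dotDual_dec_ne_zero hb hb0) 0
  have h1 := hg.walsh _ (dotDual (dec a)) (dotDual_dec_ne_zero hb hb0) 1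
  have h2 := Finset.card_filter_add_card_filter_not (s := (Finset.univ : Finset (Vec 4)))
    fun x => dotDual (dec b) (g x) + dotDual (dec a) x = 1
  have h3 : (Finset.univ.filter fun x => ¬ dotDual (dec b) (g x) + dotDual (dec a) x = 1) =
      Finset.univ.filter fun x => dotDual (dec b) (g x) + dotDual (dec a) x = 0 := by
    refine Finset.filter_congr fun x _ => ?_
    generalize dotDual (dec b) (g x) + dotDual (dec a) x = z
    revert z; decide
  have h4 : (Finset.univ : Finset (Vec 4)).card = 16 := by simp [ZMod.card]
  rw [h3, h4] at h2
  unfold unbalanced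
  rw [hcount]
  simp only [Bool.or_eq_false_iff, decide_eq_false_iff_not]
  omega

theorem Resistant.leaf_encode {g : Vec 4 → Vec 4} (hg : Resistant g) :
    leaf (prefixList (encode g) 16) = false := by
  by_contra h
  rw [Bool.not_eq_false, leaf, Bool.or_eq_true] at h
  rcases h with h | h
  · simp only [Bool.and_eq_true, Bool.or_eq_true, beq_iff_eq] at h
    obtain ⟨h8, ((h | h) | h) | h⟩ := h <;>
      exact hg.moment_encode (by decide) (by decide) (by decide) (by decide) (by decide) h8 h
  · obtain ⟨a, ha, h⟩ := List.any_eq_true.1 h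
    obtain ⟨b, hb, h⟩ := List.any_eq_true.1 h
    have hb2 : b < 16 ∧ b ≠ 0 := by
      revert b; simp
    rw [hg.unbalanced_encode hb2.1 (List.mem_range.1 ha) hb2.2] at h
    exact Bool.false_ne_true h

/-- A point and the difference determine the other point, so distinct pairs with equal difference
cannot meet. -/
theorem pairs_disjoint {e e' : ℕ × ℕ} (he : e.2 < e.1) (he' : e'.2 < e'.1) (hne : e ≠ e')
    (h : e.1 ^^^ e.2 = e'.1 ^^^ e'.2) :
    e.1 ≠ e'.1 ∧ e.1 ≠ e'.2 ∧ e.2 ≠ e'.1 ∧ e.2 ≠ e'.2 := by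
  obtain ⟨x, y⟩ := e
  obtain ⟨x', y'⟩ := e'
  dsimp only at *
  refine ⟨?_, ?_, ?_, ?_⟩ <;> rintro rfl
  · exact hne (by rw [Nat.xor_right_inj.1 h])
  · rw [Nat.xor_comm x' x] at h
    have := Nat.xor_right_inj.1 h
    omega
  · rw [Nat.xor_comm x y] at h
    have := Nat.xor_right_inj.1 h
    omega
  · exact hne (by rw [Nat.xor_left_inj.1 h])

/-- Three distinct pairs with one key would be disjoint and give six solutions of a single
derivative equation, which has at most four. -/
theorem Resistant.key_encode {g : Vec 4 → Vec 4} (hg : Resistant g) (e₁ e₂ e₃ : ℕ × ℕ)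
    (h₁ : e₁.2 < e₁.1) (h₁' : e₁.1 < 16) (h₂ : e₂.2 < e₂.1) (h₂' : e₂.1 < 16)
    (h₃ : e₃.2 < e₃.1) (h₃' : e₃.1 < 16) (h₁₂ : key (encode g) e₁ = key (encode g) e₂)
    (h₁₃ : key (encode g) e₁ = key (encode g) e₃) : e₁ = e₂ ∨ e₁ = e₃ ∨ e₂ = e₃ := by
  have hsplit : ∀ e e' : ℕ × ℕ, key (encode g) e = key (encode g) e' →
      e.1 ^^^ e.2 = e'.1 ^^^ e'.2 ∧
      g (dec e.1) + g (dec e.2) = g (dec e'.1) + g (dec e'.2) := by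
    intro e e' h
    rw [key, key, encode, encode, encode, encode, ← code_add, ← code_add] at h
    have h1 := code_lt (g (dec e.1) + g (dec e.2))
    have h2 := code_lt (g (dec e'.1) + g (dec e'.2))
    exact ⟨by omega, code_injective (by omega)⟩
  by_contra! hne
  obtain ⟨n₁₂, n₁₃, n₂₃⟩ := hne
  obtain ⟨x₁₂, v₁₂⟩ := hsplit _ _ h₁₂
  obtain ⟨x₁₃, v₁₃⟩ := hsplit _ _ h₁₃
  have d₁₂ := pairs_disjoint h₁ h₂ n₁₂ x₁₂
  have d₁₃ := pairs_disjoint h₁ h₃ n₁₃ x₁₃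
  have d₂₃ := pairs_disjoint h₂ h₃ n₂₃ (x₁₂.symm.trans x₁₃)
  have hcard : ({e₁.1, e₁.2, e₂.1, e₂.2, e₃.1, e₃.2} : Finset ℕ).card = 6 := by
    have := h₁.ne'
    have := h₂.ne'
    have := h₃.ne'
    rw [Finset.card_insert_of_notMem, Finset.card_insert_of_notMem, Finset.card_insert_of_notMem,
      Finset.card_insert_of_notMem, Finset.card_insert_of_notMem, Finset.card_singleton] <;>
      simp only [Finset.mem_insert, Finset.mem_singleton] <;> tauto
  have hd0 : dec (e₁.1 ^^^ e₁.2) ≠ 0 := by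
    intro h
    have := dec_inj (xor_lt_sixteen h₁' (h₁.trans h₁')) (by omega) (h.trans dec_zero.symm)
    rw [Nat.xor_eq_zero_iff] at this
    omega
  have hmem : ∀ e : ℕ × ℕ, e₁.1 ^^^ e₁.2 = e.1 ^^^ e.2 →
      g (dec e₁.1) + g (dec e₁.2) = g (dec e.1) + g (dec e.2) →
      deriv g (dec (e₁.1 ^^^ e₁.2)) (dec e.1) = g (dec e₁.1) + g (dec e₁.2) ∧
      deriv g (dec (e₁.1 ^^^ e₁.2)) (dec e.2) = g (dec e₁.1) + g (dec e₁.2) := by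
    intro e hx hv
    rw [deriv, deriv, hx, hv, ← dec_xor, ← dec_xor, Nat.xor_xor_cancel_left, Nat.xor_comm e.1 e.2,
      Nat.xor_xor_cancel_left, add_comm]
    exact ⟨rfl, rfl⟩
  have hle := hg.diff _ hd0 (g (dec e₁.1) + g (dec e₁.2))
  refine absurd (hcard.symm.le.trans ((Finset.card_le_card_of_injOn dec ?_ ?_).trans hle))
    (by norm_num)
  · intro x hx
    simp only [Finset.coe_insert, Finset.coe_singleton, Set.mem_insert_iff,
      Set.mem_singleton_iff] at hx
    rw [Finset.mem_coe, Finset.mem_filter_univ]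
    rcases hx with rfl | rfl | rfl | rfl | rfl | rfl
    · exact (hmem e₁ rfl rfl).1
    · exact (hmem e₁ rfl rfl).2
    · exact (hmem e₂ x₁₂ v₁₂).1
    · exact (hmem e₂ x₁₂ v₁₂).2
    · exact (hmem e₃ x₁₃ v₁₃).1
    · exact (hmem e₃ x₁₃ v₁₃).2
  · have hlt : ∀ x ∈ (({e₁.1, e₁.2, e₂.1, e₂.2, e₃.1, e₃.2} : Finset ℕ) : Set ℕ), x < 16 := by
      intro x hx
      simp only [Finset.coe_insert, Finset.coe_singleton, Set.mem_insert_iff,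
        Set.mem_singleton_iff] at hx
      omega
    exact fun x hx y hy h => dec_inj (hlt x hx) (hlt y hy) h

theorem Resistant.not_normalized {g : Vec 4 → Vec 4} (hg : Resistant g) {t : ℕ}
    (ht : t = 3 ∨ t = 7 ∨ t = 8) (h0 : g 0 = 0) (h1 : g (dec 1) = dec 1)
    (hstep : ∀ x, ∃ s ∈ [1, 2, 4, t], g (x + dec 1) + g x = dec s)
    (hleast : ∀ n ∈ [2, 4, 8], ∀ y, n ≤ y → y < 16 → code (g (dec n)) ≤ code (g (dec y))) :
    False := by
  have hadm : Admissible t (encode g) := by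
    refine ⟨fun x _ => code_lt _, fun x hx y hy h => dec_inj hx hy (hg.inj (code_injective h)),
      ?_, ?_, fun x hx hx2 => ?_, fun n hn w hw => ?_, hg.key_encode⟩
    · rw [encode, dec_zero, h0]; rfl
    · rw [encode, h1, code_dec (by omega)]
    · have hx1 : x + 1 = x ^^^ 1 := by
        revert hx2; revert x; decide
      obtain ⟨s, hs, h⟩ := hstep (dec x)
      have hs16 : s < 16 := by
        simp only [List.mem_cons, List.not_mem_nil, or_false] at hs
        omega
      have hval : encode g (x + 1) = encode g x ^^^ s := by
        rw [encode, hx1, dec_xor, add_eq_iff_vec.1 h, code_add, code_dec hs16, Nat.xor_comm]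
        rfl
      rw [hval]
      simp only [List.mem_cons, List.not_mem_nil, or_false] at hs ⊢
      rcases hs with rfl | rfl | rfl | rfl <;> simp
    · have hw16 : w < 16 := hw.trans (code_lt _)
      -- The value `w` is attained somewhere, and by `hleast` not at a point from `n` on.
      obtain ⟨x, hx⟩ := Finite.surjective_of_injective hg.inj (dec w)
      have hval : encode g (code x) = w := by
        rw [encode, dec_code, hx, code_dec hw16]
      refine ⟨code x, ?_, hval⟩
      by_contra hle
      have := hleast n hn (code x) (by omega) (code_lt x)
      change encode g n ≤ encode g (code x) at this
      omega
  exact Bool.false_ne_true (hg.leaf_encode.symm.trans (hadm.leaf_prefixList ht))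

/-! ### Normalization by linear automorphisms -/

/-- The linear combinations of three vectors. -/
def span₃ (a b c : Vec 4) : Finset (Vec 4) :=
  {0, a, b, a + b, c, a + c, b + c, a + b + c}

theorem exists_notMem_span₃ (a b c : Vec 4) : ∃ d, d ∉ span₃ a b c := by
  by_contra! h
  have h1 : (span₃ a b c).card = 16 := by
    rw [Finset.eq_univ_iff_forall.2 h]; simp [ZMod.card]
  have h2 : (span₃ a b c).card ≤ 8 := by
    unfold span₃
    refine (Finset.card_insert_le _ _).trans (Nat.succ_le_succ ?_)
    refine (Finset.card_insert_le _ _).trans (Nat.succ_le_succ Finset.card_le_six)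
  omega

theorem exists_linearEquiv {a b c d : Vec 4} (ha : a ≠ 0) (hb : b ∉ ({0, a} : Finset (Vec 4)))
    (hc : c ∉ ({0, a, b, a + b} : Finset (Vec 4))) (hd : d ∉ span₃ a b c) :
    ∃ L : Vec 4 ≃ₗ[ZMod 2] Vec 4,
      L (dec 1) = a ∧ L (dec 2) = b ∧ L (dec 4) = c ∧ L (dec 8) = d := by
  have hli : LinearIndependent (ZMod 2) ![a, b, c, d] := by
    rw [Fintype.linearIndependent_iff]
    intro k hk
    have hz : ∀ z : ZMod 2, z = 0 ∨ z = 1 := by decide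
    have hadd : ∀ x y : Vec 4, x + y = 0 → y = x := fun x y h => by
      rw [← zero_add x, ← add_eq_iff_vec, add_comm, h]
    rw [Fin.sum_univ_four] at hk
    change k 0 • a + k 1 • b + k 2 • c + k 3 • d = 0 at hk
    simp only [span₃, Finset.mem_insert, Finset.mem_singleton, not_or] at hb hc hd
    have h3 : k 3 = 0 := by
      refine (hz _).resolve_right fun h => ?_
      rw [h, one_smul] at hk
      have := hadd _ _ hk
      rcases hz (k 0) with h0 | h0 <;> rcases hz (k 1) with h1 | h1 <;>
        rcases hz (k 2) with h2 | h2 <;>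
        simp only [h0, h1, h2, zero_smul, one_smul, zero_add, add_zero] at this <;> tauto
    rw [h3, zero_smul, add_zero] at hk
    have h2 : k 2 = 0 := by
      refine (hz _).resolve_right fun h => ?_
      rw [h, one_smul] at hk
      have := hadd _ _ hk
      rcases hz (k 0) with h0 | h0 <;> rcases hz (k 1) with h1 | h1 <;>
        simp only [h0, h1, zero_smul, one_smul, zero_add, add_zero] at this <;> tauto
    rw [h2, zero_smul, add_zero] at hk
    have h1 : k 1 = 0 := by
      refine (hz _).resolve_right fun h => ?_
      rw [h, one_smul] at hk
      have := hadd _ _ hk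
      rcases hz (k 0) with h0 | h0 <;>
        simp only [h0, zero_smul, one_smul] at this <;> tauto
    rw [h1, zero_smul, add_zero] at hk
    have h0 : k 0 = 0 := (smul_eq_zero.1 hk).resolve_right ha
    intro i
    fin_cases i <;> assumption
  let B := basisOfLinearIndependentOfCardEqFinrank hli (by simp)
  have hB : ⇑B = ![a, b, c, d] := coe_basisOfLinearIndependentOfCardEqFinrank hli (by simp)
  have key : ∀ i, (Pi.basisFun (ZMod 2) (Fin 4)).equiv B (Equiv.refl _) (Pi.single i 1) = B i := by
    intro i
    rw [← Pi.basisFun_apply (ZMod 2) (Fin 4) i, Module.Basis.equiv_apply]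
    rfl
  refine ⟨(Pi.basisFun (ZMod 2) (Fin 4)).equiv B (Equiv.refl _), ?_, ?_, ?_, ?_⟩
  · rw [show dec 1 = Pi.single 0 1 by decide, key, hB]; rfl
  · rw [show dec 2 = Pi.single 1 1 by decide, key, hB]; rfl
  · rw [show dec 4 = Pi.single 2 1 by decide, key, hB]; rfl
  · rw [show dec 8 = Pi.single 3 1 by decide, key, hB]; rfl

/-- Extend `u` to a basis `u, b, c, d`, each new vector minimizing `code ∘ f` outside the span of
the previous ones. For `n = 2, 4, 8`, the numbers from `n` on encode exactly the vectors outside the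
span of the earlier basis vectors, which is the minimality the search assumes. -/
theorem Resistant.deriv_ne {f : Vec 4 → Vec 4} (hf : Resistant f) {u : Vec 4} (hu : u ≠ 0)
    {t : ℕ} (ht : t = 3 ∨ t = 7 ∨ t = 8) (h0 : f 0 = 0) (h1 : f u = dec 1)
    (hstep : ∀ x, ∃ s ∈ [1, 2, 4, t], f (x + u) + f x = dec s) : False := by
  have hne : ∀ (S : Finset (Vec 4)) (x : Vec 4), x ∉ S → ∃ v ∉ S, ∀ y ∉ S,
      code (f v) ≤ code (f y) := by
    intro S x hx
    obtain ⟨v, hv, h⟩ := Finset.exists_min_image Sᶜ (fun v => code (f v))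
      ⟨x, Finset.mem_compl.2 hx⟩
    exact ⟨v, Finset.mem_compl.1 hv, fun y hy => h y (Finset.mem_compl.2 hy)⟩
  obtain ⟨b₀, hb₀⟩ := exists_notMem_span₃ u 0 0
  obtain ⟨b, hb, hbmin⟩ := hne {0, u} b₀ (by simp [span₃] at hb₀ ⊢; tauto)
  obtain ⟨c₀, hc₀⟩ := exists_notMem_span₃ u b 0
  obtain ⟨c, hc, hcmin⟩ := hne {0, u, b, u + b} c₀ (by simp [span₃] at hc₀ ⊢; tauto)
  obtain ⟨d₀, hd₀⟩ := exists_notMem_span₃ u b c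
  obtain ⟨d, hd, hdmin⟩ := hne (span₃ u b c) d₀ hd₀
  obtain ⟨L, hL1, hL2, hL4, hL8⟩ := exists_linearEquiv hu hb hc hd
  have hL0 : L (dec 0) = 0 := by rw [dec_zero, map_zero]
  have hL3 : L (dec 3) = u + b := by rw [show dec 3 = dec 1 + dec 2 by decide, map_add, hL1, hL2]
  have hL5 : L (dec 5) = u + c := by rw [show dec 5 = dec 1 + dec 4 by decide, map_add, hL1, hL4]
  have hL6 : L (dec 6) = b + c := by rw [show dec 6 = dec 2 + dec 4 by decide, map_add, hL2, hL4]
  have hL7 : L (dec 7) = u + b + c := by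
    rw [show dec 7 = dec 3 + dec 4 by decide, map_add, hL3, hL4]
  have hLne : ∀ j y, j < y → y < 16 → L (dec y) ≠ L (dec j) := fun j y hj hy h =>
    hj.ne' (dec_inj hy (hj.trans hy) (L.injective h))
  have hg : Resistant fun x => f (L x) := by simpa using hf.comp_right L 0
  refine hg.not_normalized ht (by rw [map_zero, h0]) (by rw [hL1, h1]) (fun x => ?_) ?_
  · simpa only [map_add, hL1] using hstep (L x)
  · intro n hn y hny hy
    simp only [List.mem_cons, List.not_mem_nil, or_false] at hn
    rcases hn with rfl | rfl | rfl
    · rw [hL2]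
      refine hbmin _ ?_
      simp only [Finset.mem_insert, Finset.mem_singleton, not_or]
      rw [← hL1, ← hL0]
      exact ⟨hLne 0 y (by omega) hy, hLne 1 y (by omega) hy⟩
    · rw [hL4]
      refine hcmin _ ?_
      simp only [Finset.mem_insert, Finset.mem_singleton, not_or]
      rw [← hL3, ← hL2, ← hL1, ← hL0]
      exact ⟨hLne 0 y (by omega) hy, hLne 1 y (by omega) hy, hLne 2 y (by omega) hy,
        hLne 3 y (by omega) hy⟩
    · rw [hL8]
      refine hdmin _ ?_
      simp only [span₃, Finset.mem_insert, Finset.mem_singleton, not_or]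
      rw [← hL7, ← hL6, ← hL5, ← hL4, ← hL3, ← hL2, ← hL1, ← hL0]
      exact ⟨hLne 0 y (by omega) hy, hLne 1 y (by omega) hy, hLne 2 y (by omega) hy,
        hLne 3 y (by omega) hy, hLne 4 y (by omega) hy, hLne 5 y (by omega) hy,
        hLne 6 y (by omega) hy, hLne 7 y (by omega) hy⟩

/-- Four distinct nonzero vectors, suitably ordered, are mapped by a linear automorphism to three
unit vectors and one of three further vectors. -/
theorem exists_linearEquiv_of_card_eq_four {A : Finset (Vec 4)} (hA : A.card = 4) (h0 : 0 ∉ A) :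
    ∃ M : Vec 4 ≃ₗ[ZMod 2] Vec 4, ∃ t, (t = 3 ∨ t = 7 ∨ t = 8) ∧ M.symm (dec 1) ∈ A ∧
      ∀ x ∈ A, ∃ s ∈ [1, 2, 4, t], M x = dec s := by
  have main : ∀ a b c d : Vec 4, a ≠ 0 → b ∉ ({0, a} : Finset (Vec 4)) →
      c ∉ ({0, a, b, a + b} : Finset (Vec 4)) → a ∈ A → (∀ x ∈ A, x = a ∨ x = b ∨ x = c ∨ x = d) →
      (d = a + b ∨ d = a + b + c ∨ d ∉ span₃ a b c) →
      ∃ M : Vec 4 ≃ₗ[ZMod 2] Vec 4, ∃ t, (t = 3 ∨ t = 7 ∨ t = 8) ∧ M.symm (dec 1) ∈ A ∧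
        ∀ x ∈ A, ∃ s ∈ [1, 2, 4, t], M x = dec s := by
    intro a b c d ha hb hc haA hall hd
    obtain ⟨e, t, he, ht, hed⟩ : ∃ e t, e ∉ span₃ a b c ∧ (t = 3 ∨ t = 7 ∨ t = 8) ∧
        ∀ L : Vec 4 ≃ₗ[ZMod 2] Vec 4, L (dec 1) = a → L (dec 2) = b → L (dec 4) = c →
          L (dec 8) = e → L (dec t) = d := by
      obtain ⟨e, he⟩ := exists_notMem_span₃ a b c
      rcases hd with rfl | rfl | hd
      · refine ⟨e, 3, he, by simp, fun L h1 h2 _ _ => ?_⟩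
        rw [show dec 3 = dec 1 + dec 2 by decide, map_add, h1, h2]
      · refine ⟨e, 7, he, by simp, fun L h1 h2 h4 _ => ?_⟩
        rw [show dec 7 = dec 1 + dec 2 + dec 4 by decide, map_add, map_add, h1, h2, h4]
      · exact ⟨d, 8, hd, by simp, fun L _ _ _ h => h⟩
    obtain ⟨L, h1, h2, h4, h8⟩ := exists_linearEquiv ha hb hc he
    refine ⟨L.symm, t, ht, by rwa [LinearEquiv.symm_symm, h1], fun x hx => ?_⟩
    have ht := hed L h1 h2 h4 h8
    rcases hall x hx with rfl | rfl | rfl | rfl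
    · exact ⟨1, by simp, by rw [← h1, L.symm_apply_apply]⟩
    · exact ⟨2, by simp, by rw [← h2, L.symm_apply_apply]⟩
    · exact ⟨4, by simp, by rw [← h4, L.symm_apply_apply]⟩
    · exact ⟨t, by simp, by rw [← ht, L.symm_apply_apply]⟩
  obtain ⟨a, b, c, d, hab, hac, had, hbc, hbd, hcd, rfl⟩ := Finset.card_eq_four.1 hA
  simp only [Finset.mem_insert, Finset.mem_singleton, not_or] at h0 main ⊢
  obtain ⟨ha, hb, hc, hd⟩ := h0
  have hrot : ∀ {x y z : Vec 4}, x = y + z → z = y + x := by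
    intro x y z h
    rw [add_comm y x, ← add_eq_iff_vec, add_comm z y, h]
  -- A linear relation among three of the vectors is `c = a + b` or `d` equal to `a + b`, `a + c` or
  -- `b + c`. Reordering makes the last vector the sum of the first two; `d = a + b` needs none.
  by_cases hcab : c = a + b
  · exact main a b d c (Ne.symm ha) ⟨Ne.symm hb, hab.symm⟩
      ⟨Ne.symm hd, had.symm, hbd.symm, fun h => hcd (hcab.trans h.symm)⟩ (by simp)
      (fun x hx => by rcases hx with h | h | h | h <;> simp [h]) (Or.inl hcab)
  by_cases hdac : d = a + c
  · exact main a c b d (Ne.symm ha) ⟨Ne.symm hc, hac.symm⟩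
      ⟨Ne.symm hb, hab.symm, hbc, fun h => hcab (hrot h)⟩ (by simp)
      (fun x hx => by rcases hx with h | h | h | h <;> simp [h]) (Or.inl hdac)
  by_cases hdbc : d = b + c
  · exact main b c a d (Ne.symm hb) ⟨Ne.symm hc, hbc.symm⟩
      ⟨Ne.symm ha, hab, hac, fun h => hcab ((hrot h).trans (add_comm _ _))⟩ (by simp)
      (fun x hx => by rcases hx with h | h | h | h <;> simp [h]) (Or.inl hdbc)
  refine main a b c d (Ne.symm ha) ⟨Ne.symm hb, hab.symm⟩ ⟨Ne.symm hc, hac.symm, hbc.symm, hcab⟩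
    (by simp) (fun x hx => hx)
    (or_iff_not_imp_left.2 fun hdab => or_iff_not_imp_left.2 fun hdabc => ?_)
  simp only [span₃, Finset.mem_insert, Finset.mem_singleton, not_or]
  exact ⟨Ne.symm hd, had.symm, hbd.symm, hdab, hcd.symm, hdac, hdbc, hdabc⟩

theorem Resistant.weaklyAPN {f : Vec 4 → Vec 4} (hf : Resistant f) : WeaklyAPN f := by
  intro u hu
  by_contra h
  have hle : (Finset.univ.image (deriv f u)).card ≤ 4 := by
    have h4 : (2 : ℚ) ^ (((4 : ℕ) : ℤ) - 1) / ((2 : ℕ) : ℚ) = ((4 : ℕ) : ℚ) := by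
      norm_num [zpow_ofNat]
    rw [h4, not_lt] at h
    exact_mod_cast h
  -- Sixteen points in fibres of size at most four need at least four values, so the image has
  -- exactly four.
  have hge := Finset.card_le_mul_card_image (f := deriv f u) Finset.univ 4
    fun v _ => hf.diff u hu v
  have huniv : (Finset.univ : Finset (Vec 4)).card = 16 := by simp [ZMod.card]
  obtain ⟨M, t, ht, h1, hM⟩ := exists_linearEquiv_of_card_eq_four
    (A := Finset.univ.image (deriv f u)) (by omega) (by
      intro h
      obtain ⟨x, -, hx⟩ := Finset.mem_image.1 h
      have := hf.inj (add_eq_iff_vec.1 hx |>.trans (zero_add _))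
      simp [hu] at this)
  -- Moving `x₀` to the origin makes the new function vanish at `0` and take the value `M (deriv f u
  -- x₀) = dec 1` at `u`.
  obtain ⟨x₀, -, hx₀⟩ := Finset.mem_image.1 h1
  have hg : Resistant fun x => M (f (x + x₀) + f x₀) :=
    (hf.comp_right (LinearEquiv.refl _ _) x₀).comp_left M (f x₀)
  refine hg.deriv_ne hu ht ?_ ?_ fun x => ?_
  · rw [zero_add, add_self_vec, map_zero]
  · rw [add_comm u x₀]
    change M (deriv f u x₀) = _
    rw [hx₀, M.apply_symm_apply]
  · obtain ⟨s, hs, h⟩ := hM _ (Finset.mem_image_of_mem (deriv f u) (Finset.mem_univ (x + x₀)))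
    refine ⟨s, hs, ?_⟩
    rw [← h, ← map_add, deriv, add_add_add_comm, add_self_vec, add_zero, add_right_comm]

end SBox

theorem fact6 (f : SBox.Vec 4 → SBox.Vec 4) (hf : Function.Bijective f)
    (hlin : SBox.lin f = 8) (hdiff : SBox.DifferentiallyUniform 4 f)
    (hdeg : 14 ≤ SBox.numComponents 3 f) :
    SBox.WeaklyAPN f :=
  (SBox.resistant_of_lin hf.injective hlin.le hdiff hdeg).weaklyAPN
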